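/- Let $H$ be a finite-dimensional complex Hilbert space. For positive operators $X,Y$ on $H$ with $X$ invertible and $\alpha\in[0,1]$ let $X\sharp_\alpha Y = X^{1/2}(X^{-1/2}YX^{-1/2})^{\alpha}X^{1/2}$. For $w>0$, $w\neq 1$ and $0<\alpha<1$ let $$K(w,\alpha)=\frac{w^\alpha-w}{(\alpha-1)(w-1)}\left(\frac{\alpha-1}{\alpha}\cdot\frac{w^\alpha-1}{w^\alpha-w}\right)^{\alpha},\qquad K(1,\alpha)=1,$$ be the generalized Kantorovich constant. Theorem. Let $f:[0,\infty)\to[0,\infty)$ be continuous, increasing (that is, non-decreasing), and doubly concave, i.e. concave and geometrically concave: $f(x^{\alpha}y^{1-\alpha})\ge f(x)^{\alpha}f(y)^{1-\alpha}$ for all $x,y\ge 0$ and $\alpha\in[0,1]$. Let $p,q>1$ with $\frac1p+\frac1q=1$, and let $A,B$ be positive operators on $H$ with $0<sA^p\le B^q\le tA^p$ for some scalars $0<s\le t$; put $w=t/s$. (If $f\equiv 0$, read $0\,\sharp_{1/q}\,0=0$; otherwise $f(A^p)$ is invertible.) Then there is a unitary operator $U$ on $H$ such that $$f\left(A^p\sharp_{1/q}B^q\right)\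 \ge\ K(w,1/q)\;U\left(f(A^p)\sharp_{1/q}f(B^q)\right)U^*,$$ and, with the same $U$, if in addition $s\le 1\le t$ and $f$ is operator monotone on $H$ (that is, $f(S)\ge f(T)$ whenever $S\ge T$ are strictly positive operators on $H$), then for all $x\in H$ $$\left\langle f\left(A^p\sharp_{1/q}B^q\right)Ux,Ux\right\rangle\ \ge\ K(w,1/q)^2\,\langle f(A^p)x,x\rangle^{1/p}\,\langle f(B^q)x,x\rangle^{1/q}.$$ -/

import Mathlib

open Set

noncomputable section

/-- A non-negative continuous function on `J ⊆ [0, ∞)` is doubly concave if it is concave and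
geometrically concave on `J`. -/
structure DoublyConcaveOn (J : Set ℝ) (f : ℝ → ℝ) : Prop where
  nonneg : ∀ x ∈ J, 0 ≤ f x
  continuousOn : ContinuousOn f J
  concave : ConcaveOn ℝ J f
  geomConcave : ∀ x ∈ J, ∀ y ∈ J, ∀ α ∈ Icc (0 : ℝ) 1,
    f x ^ α * f y ^ (1 - α) ≤ f (x ^ α * y ^ (1 - α))

/-- The generalized Kantorovich constant `K(w, α)` for `w > 0` and `0 < α < 1`. At `w = 1`, where
the displayed formula reads `0 / 0`, it is given its limit value `1`. -/
def genKantorovich (w α : ℝ) : ℝ :=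
  if w = 1 then 1
  else (w ^ α - w) / ((α - 1) * (w - 1)) *
    ((α - 1) / α * ((w ^ α - 1) / (w ^ α - w))) ^ α

section Operators

variable {H : Type*} [NormedAddCommGroup H] [InnerProductSpace ℂ H] [CompleteSpace H]

/-- The weighted geometric mean `A ♯_α B = A^{1/2} (A^{-1/2} B A^{-1/2})^α A^{1/2}`. -/
def opGeomMean (α : ℝ) (A B : H →L[ℂ] H) : H →L[ℂ] H :=
  A ^ (1 / 2 : ℝ) * (A ^ (-(1 / 2) : ℝ) * B * A ^ (-(1 / 2) : ℝ)) ^ α * A ^ (1 / 2 : ℝ)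

variable (H) in
/-- `f` is operator monotone on `(0, ∞)`, for operators on the given space `H`: `B ≤ A` implies
`f(B) ≤ f(A)` for strictly positive `A`, `B`. (This is implied by monotonicity on every Hilbert
space.) -/
def OperatorMonotone (f : ℝ → ℝ) : Prop :=
  ∀ A B : H →L[ℂ] H, IsStrictlyPositive A → IsStrictlyPositive B → B ≤ A → cfc f B ≤ cfc f A

end Operators

end

noncomputable section

/-! ### Scalar inequalities -/

/-! Write `C = A ^ p`, `D = B ^ q`, `α = 1 / q`. Everything is reduced to scalars through quadratic
forms. At every vector, Hölder bounds the form of `C ♯_α D` above by `⟨Dx,x⟩^α ⟨Cx,x⟩^(1-α)`; since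
`sC ≤ D ≤ tC`, replacing the power by its chord on `[s, t]` gives the reverse bound with the loss
`K`.

For unit `x`, Hölder for `f(C) ♯_α f(D)`, Jensen, geometric concavity, `K f(y) ≤ f(K y)` (as `0 ≤ K
≤ 1`), monotonicity and the reverse bound give `K ⟨(f(C) ♯_α f(D))x,x⟩ ≤ f(⟨(C ♯_α D)x,x⟩)`
(`genKantorovich_mul_quadForm_opGeomMean_cfc_le`). A minimax argument turns this into domination of
ordered eigenvalues, which provides `U` (`exists_unitary_conj_le_cfc`).

For the second claim, operator monotonicity and `s ≤ 1 ≤ t` give `s f(C) ≤ f(sC) ≤ f(D) ≤ f(tC) ≤ t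
f(C)`. The reverse Hölder bound then applies to `f(C), f(D)` with the same `s, t`, which costs the
second factor `K`. -/

/-- A concave function on `[0, ∞)` has a supporting line at each positive point. -/
theorem ConcaveOn.exists_supporting_line {f : ℝ → ℝ} (hf : ConcaveOn ℝ (Ici 0) f) {m : ℝ}
    (hm : 0 < m) : ∃ k : ℝ, ∀ x, 0 ≤ x → f x ≤ k * x + (f m - k * m) := by
  have hint : m ∈ interior (Ici (0 : ℝ)) := by simpa using hm
  have hd : DifferentiableWithinAt ℝ (-f) (Ioi m) m :=
    (hf.neg.hasDerivWithinAt_rightDeriv_of_mem_interior hint).differentiableWithinAt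
  have hdl : DifferentiableWithinAt ℝ (-f) (Iio m) m :=
    (hf.neg.hasDerivWithinAt_leftDeriv_of_mem_interior hint).differentiableWithinAt
  -- The slope is the right derivative of `f` at `m`, expressed through the convex function `-f`.
  refine ⟨-derivWithin (-f) (Ioi m) m, fun x hx => ?_⟩
  rcases lt_trichotomy x m with h | h | h
  · have h1 := hf.neg.slope_le_leftDeriv (mem_Ici.2 hx) (mem_Ici.2 hm.le) h hdl
    have h2 := hf.neg.leftDeriv_le_rightDeriv_of_mem_interior hint
    have h3 := h1.trans h2
    rw [slope_def_field, div_le_iff₀ (sub_pos.2 h)] at h3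
    simp only [Pi.neg_apply] at h3
    linarith
  · subst h; linarith
  · have h1 := hf.neg.rightDeriv_le_slope (mem_Ici.2 hm.le) (mem_Ici.2 hx) h hd
    rw [slope_def_field, le_div_iff₀ (sub_pos.2 h)] at h1
    simp only [Pi.neg_apply] at h1
    linarith

/-- The point `k * x` is a convex combination of `x` and `0`, and the term `(1 - k) * f 0` is
non-negative. -/
theorem ConcaveOn.mul_le_map_mul {f : ℝ → ℝ} (hf : ConcaveOn ℝ (Ici 0) f) (h0 : 0 ≤ f 0)
    {k x : ℝ} (hk0 : 0 ≤ k) (hk1 : k ≤ 1) (hx : 0 ≤ x) : k * f x ≤ f (k * x) := by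
  have h := hf.2 (mem_Ici.2 hx) (mem_Ici.2 le_rfl) hk0 (sub_nonneg.2 hk1) (by ring)
  simp only [smul_eq_mul, mul_zero, add_zero] at h
  nlinarith [mul_nonneg (sub_nonneg.2 hk1) h0]

theorem ConcaveOn.map_mul_le_mul {f : ℝ → ℝ} (hf : ConcaveOn ℝ (Ici 0) f) (h0 : 0 ≤ f 0)
    {k x : ℝ} (hk : 1 ≤ k) (hx : 0 ≤ x) : f (k * x) ≤ k * f x := by
  have hk0 : 0 < k := by linarith
  have h := hf.mul_le_map_mul h0 (inv_nonneg.2 hk0.le) (inv_le_one_of_one_le₀ hk)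
    (mul_nonneg hk0.le hx)
  rw [inv_mul_cancel_left₀ hk0.ne', inv_mul_le_iff₀ hk0] at h
  exact h

/-- A non-negative concave function on `[0, ∞)` vanishes identically or is positive on `(0, ∞)`. -/
theorem ConcaveOn.eq_zero_or_pos {f : ℝ → ℝ} (hf : ConcaveOn ℝ (Ici 0) f)
    (hmono : MonotoneOn f (Ici 0)) (h0 : ∀ x ∈ Ici (0 : ℝ), 0 ≤ f x) :
    (∀ x ∈ Ici (0 : ℝ), f x = 0) ∨ ∀ x, 0 < x → 0 < f x := by
  by_cases h : ∀ x, 0 < x → 0 < f x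
  · exact Or.inr h
  left
  push Not at h
  obtain ⟨z, hz, hfz⟩ := h
  intro x hx
  refine le_antisymm ?_ (h0 x hx)
  rcases le_total x z with hxz | hxz
  · exact (hmono hx (mem_Ici.2 hz.le) hxz).trans hfz
  · have := hf.map_mul_le_mul (h0 0 (mem_Ici.2 le_rfl)) (k := x / z) (x := z)
      ((one_le_div hz).2 hxz) hz.le
    rw [div_mul_cancel₀ _ hz.ne'] at this
    exact this.trans (mul_nonpos_of_nonneg_of_nonpos (div_nonneg hx hz.le) hfz)

/-- The right side is the tangent at `c`; the bound is weighted AM-GM for `x` and `c`, rescaled by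
`c ^ (α - 1)`. -/
theorem rpow_le_tangent {α c x : ℝ} (hα0 : 0 < α) (hα1 : α < 1) (hc : 0 < c) (hx : 0 ≤ x) :
    x ^ α ≤ α * c ^ (α - 1) * x + (1 - α) * c ^ α := by
  have h := Real.geom_mean_le_arith_mean2_weighted hα0.le (sub_nonneg.2 hα1.le) hx hc.le (by ring)
  have h2 := mul_le_mul_of_nonneg_left h (Real.rpow_nonneg hc.le (α - 1))
  have e1 : c ^ (α - 1) * c ^ (1 - α) = 1 := by
    rw [← Real.rpow_add hc]; simp
  have e2 : c ^ (α - 1) * c = c ^ α := by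
    rw [Real.rpow_sub_one hc.ne', div_mul_cancel₀ _ hc.ne']
  calc x ^ α = c ^ (α - 1) * (x ^ α * c ^ (1 - α)) := by
        rw [mul_left_comm, e1, mul_one]
    _ ≤ _ := h2
    _ = α * c ^ (α - 1) * x + (1 - α) * (c ^ (α - 1) * c) := by ring
    _ = _ := by rw [e2]

/-- Weighted AM-GM for `a / α * u` and `b / (1 - α) * v`. It converts an affine lower bound for a
power into a product lower bound. -/
theorem weighted_geom_le_linear {α a b u v : ℝ} (hα0 : 0 < α) (hα1 : α < 1) (ha : 0 ≤ a)
    (hb : 0 ≤ b) (hu : 0 ≤ u) (hv : 0 ≤ v) :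
    (a / α) ^ α * (b / (1 - α)) ^ (1 - α) * (u ^ α * v ^ (1 - α)) ≤ a * u + b * v := by
  have hβ : 0 < 1 - α := sub_pos.2 hα1
  have h := Real.geom_mean_le_arith_mean2_weighted hα0.le hβ.le
    (mul_nonneg (div_nonneg ha hα0.le) hu) (mul_nonneg (div_nonneg hb hβ.le) hv) (by ring)
  rw [Real.mul_rpow (div_nonneg ha hα0.le) hu, Real.mul_rpow (div_nonneg hb hβ.le) hv] at h
  have e : α * (a / α * u) + (1 - α) * (b / (1 - α) * v) = a * u + b * v := by
    field_simp
  rw [e] at h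
  refine le_trans (le_of_eq ?_) h
  ring

/-- The two quotients are the slope and intercept of the chord of `x ^ α` over `[s, t]`, so the
Kantorovich constant is the AM-GM constant of that chord. The powers of `s` cancel, leaving only `w
= t / s`. -/
theorem genKantorovich_eq {s t α : ℝ} (hs : 0 < s) (hst : s < t) (hα0 : 0 < α) (hα1 : α < 1) :
    genKantorovich (t / s) α = ((t ^ α - s ^ α) / (t - s) / α) ^ α *
      ((t * s ^ α - s * t ^ α) / (t - s) / (1 - α)) ^ (1 - α) := by
  obtain ⟨w, rfl⟩ : ∃ w, t = s * w := ⟨t / s, by field_simp⟩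
  have hw : 1 < w := by
    by_contra h
    nlinarith [mul_le_mul_of_nonneg_left (not_lt.1 h) hs.le]
  have hw0 : 0 < w := by linarith
  have hβ : 0 < 1 - α := sub_pos.2 hα1
  have hP1 : 1 < w ^ α := Real.one_lt_rpow hw hα0
  have hPw : w ^ α < w := by
    simpa using Real.rpow_lt_rpow_of_exponent_lt hw hα1
  have hsα : 0 < s ^ α := Real.rpow_pos_of_pos hs α
  rw [mul_div_cancel_left₀ _ hs.ne', genKantorovich, if_neg hw.ne', Real.mul_rpow hs.le hw0.le]
  set P := w ^ α
  -- `N` and `M` are the intercept over `1 - α` and the slope over `α` for the chord on `[1, w]`;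
  -- the claim becomes `N * (M / N) ^ α = M ^ α * N ^ (1 - α)`.
  set N : ℝ := (w - P) / ((1 - α) * (w - 1)) with hN
  set M : ℝ := (P - 1) / (α * (w - 1)) with hM
  have hNpos : 0 < N := div_pos (by linarith) (mul_pos hβ (by linarith))
  have hMpos : 0 < M := div_pos (by linarith) (mul_pos hα0 (by linarith))
  have hw1 : w - 1 ≠ 0 := by linarith
  have hwP : w - P ≠ 0 := by linarith
  have hPw' : P - w ≠ 0 := by linarith
  have hα' : α - 1 ≠ 0 := by linarith
  have hsw : s * w - s ≠ 0 := by nlinarith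
  have e1 : (P - w) / ((α - 1) * (w - 1)) = N := by
    rw [hN, div_eq_div_iff (mul_ne_zero hα' hw1) (mul_ne_zero hβ.ne' hw1)]; ring
  have e2 : (α - 1) / α * ((P - 1) / (P - w)) = M / N := by
    rw [hN, hM]
    have : P - w = -(w - P) := by ring
    rw [this]
    field_simp
    ring
  have e3 : (s ^ α * P - s ^ α) / (s * w - s) / α = s ^ (α - 1) * M := by
    rw [hM, Real.rpow_sub_one hs.ne']
    field_simp
  have e4 : (s * w * s ^ α - s * (s ^ α * P)) / (s * w - s) / (1 - α) = s ^ α * N := by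
    rw [hN]
    field_simp
  rw [e1, e2, e3, e4, Real.mul_rpow (Real.rpow_nonneg hs.le _) hMpos.le,
    Real.mul_rpow hsα.le hNpos.le, ← Real.rpow_mul hs.le, ← Real.rpow_mul hs.le,
    Real.div_rpow hMpos.le hNpos.le, Real.rpow_sub hNpos, Real.rpow_one]
  have e5 : s ^ ((α - 1) * α) * s ^ (α * (1 - α)) = 1 := by
    rw [← Real.rpow_add hs]
    ring_nf
    simp
  calc N * (M ^ α / N ^ α) = (s ^ ((α - 1) * α) * s ^ (α * (1 - α))) * (M ^ α * (N / N ^ α)) := by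
        rw [e5]; ring
    _ = _ := by ring

/-- On `[s, t]` the power function dominates an affine function whose coefficients have the
generalized Kantorovich constant as their weighted geometric mean. -/
theorem exists_affine_le_rpow {s t α : ℝ} (hs : 0 < s) (hst : s ≤ t) (hα0 : 0 < α) (hα1 : α < 1) :
    ∃ a b : ℝ, 0 ≤ a ∧ 0 ≤ b ∧ (∀ x, s ≤ x → x ≤ t → a * x + b ≤ x ^ α) ∧
      genKantorovich (t / s) α = (a / α) ^ α * (b / (1 - α)) ^ (1 - α) := by
  have hβ : 0 < 1 - α := sub_pos.2 hα1
  rcases hst.eq_or_lt with rfl | hlt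
  -- For `s = t` the chord degenerates to the tangent at `s`, whose constant is `1`.
  · refine ⟨α * s ^ (α - 1), (1 - α) * s ^ α, by positivity, by positivity, ?_, ?_⟩
    · intro x h1 h2
      obtain rfl := le_antisymm h2 h1
      rw [Real.rpow_sub_one hs.ne']
      apply le_of_eq
      field_simp
      ring
    · rw [div_self hs.ne', genKantorovich, if_pos rfl, mul_div_cancel_left₀ _ hα0.ne',
        mul_div_cancel_left₀ _ hβ.ne', ← Real.rpow_mul hs.le, ← Real.rpow_mul hs.le,
        ← Real.rpow_add hs]
      ring_nf
      simp
  · have hts : 0 < t - s := sub_pos.2 hlt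
    have ht : 0 < t := hs.trans hlt
    refine ⟨(t ^ α - s ^ α) / (t - s), (t * s ^ α - s * t ^ α) / (t - s), ?_, ?_, ?_,
      genKantorovich_eq hs hlt hα0 hα1⟩
    · exact div_nonneg (sub_nonneg.2 (Real.rpow_le_rpow hs.le hst hα0.le)) hts.le
    -- After dividing by `s ^ α * t ^ α`, the intercept is non-negative because `s ^ (1 - α) ≤ t ^
    -- (1 - α)`.
    · refine div_nonneg (sub_nonneg.2 ?_) hts.le
      have h1 : s * t ^ α = (s ^ (1 - α) * s ^ α) * t ^ α := by
        rw [← Real.rpow_add hs]; simp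
      have h2 : t * s ^ α = (t ^ (1 - α) * t ^ α) * s ^ α := by
        rw [← Real.rpow_add ht]; simp
      rw [h1, h2]
      have h3 := Real.rpow_le_rpow hs.le hst hβ.le
      have h4 : 0 < s ^ α * t ^ α := by positivity
      nlinarith [mul_le_mul_of_nonneg_right h3 h4.le]
    · intro x h1 h2
      have h := (Real.concaveOn_rpow hα0.le hα1.le).2 (mem_Ici.2 hs.le) (mem_Ici.2 ht.le)
        (div_nonneg (sub_nonneg.2 h2) hts.le) (div_nonneg (sub_nonneg.2 h1) hts.le)
        (by field_simp; ring)
      simp only [smul_eq_mul] at h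
      have e : (t - x) / (t - s) * s + (x - s) / (t - s) * t = x := by
        field_simp; ring
      rw [e] at h
      refine le_trans (le_of_eq ?_) h
      field_simp
      ring

theorem genKantorovich_nonneg {s t α : ℝ} (hs : 0 < s) (hst : s ≤ t) (hα0 : 0 < α)
    (hα1 : α < 1) : 0 ≤ genKantorovich (t / s) α := by
  obtain ⟨a, b, ha, hb, -, h⟩ := exists_affine_le_rpow hs hst hα0 hα1
  have : 0 < 1 - α := sub_pos.2 hα1
  rw [h]
  positivity

/-- At the endpoint `s`, AM-GM and the affine bound give `K * s ^ α ≤ a * s + b ≤ s ^ α`. -/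
theorem genKantorovich_le_one {s t α : ℝ} (hs : 0 < s) (hst : s ≤ t) (hα0 : 0 < α)
    (hα1 : α < 1) : genKantorovich (t / s) α ≤ 1 := by
  obtain ⟨a, b, ha, hb, hab, h⟩ := exists_affine_le_rpow hs hst hα0 hα1
  have h1 := weighted_geom_le_linear hα0 hα1 ha hb hs.le zero_le_one
  rw [← h, Real.one_rpow, mul_one, mul_one] at h1
  have h2 := h1.trans (hab s le_rfl hst)
  have h3 : 0 < s ^ α := Real.rpow_pos_of_pos hs α
  exact (mul_le_iff_le_one_left h3).1 h2

end

noncomputable section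

/-! ### Quadratic forms of operators -/

section

variable {H : Type*} [NormedAddCommGroup H] [InnerProductSpace ℂ H]

/-- The quadratic form `x ↦ Re ⟪T x, x⟫`. -/
def quadForm (T : H →L[ℂ] H) (x : H) : ℝ := (inner ℂ (T x) x).re

theorem quadForm_add (S T : H →L[ℂ] H) (x : H) :
    quadForm (S + T) x = quadForm S x + quadForm T x := by
  simp [quadForm]

theorem quadForm_sub (S T : H →L[ℂ] H) (x : H) :
    quadForm (S - T) x = quadForm S x - quadForm T x := by
  simp [quadForm]

theorem quadForm_smul (c : ℝ) (T : H →L[ℂ] H) (x : H) :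
    quadForm (c • T) x = c * quadForm T x := by
  rw [quadForm, smul_apply, ← Complex.coe_smul, inner_smul_left]
  simp [quadForm]

theorem quadForm_one (x : H) : quadForm 1 x = ‖x‖ ^ 2 := by
  simp only [quadForm, one_apply_eq_self]
  exact inner_self_eq_norm_sq (𝕜 := ℂ) x

theorem quadForm_nonneg {T : H →L[ℂ] H} (hT : 0 ≤ T) (x : H) : 0 ≤ quadForm T x :=
  ((ContinuousLinearMap.nonneg_iff_isPositive T).1 hT).re_inner_nonneg_left x

theorem quadForm_mono {S T : H →L[ℂ] H} (h : S ≤ T) (x : H) : quadForm S x ≤ quadForm T x := by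
  have : 0 ≤ quadForm (T - S) x := ((ContinuousLinearMap.le_def S T).1 h).re_inner_nonneg_left x
  rw [quadForm_sub] at this
  linarith

variable [CompleteSpace H]

theorem quadForm_star_conj (S T : H →L[ℂ] H) (x : H) :
    quadForm (star S * T * S) x = quadForm T (S x) := by
  simp only [quadForm, mul_apply_eq_comp, ContinuousLinearMap.star_eq_adjoint,
    ContinuousLinearMap.adjoint_inner_left]

theorem quadForm_conj {S : H →L[ℂ] H} (hS : IsSelfAdjoint S) (T : H →L[ℂ] H) (x : H) :
    quadForm (S * T * S) x = quadForm T (S x) := by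
  simpa [hS.star_eq] using quadForm_star_conj S T x

theorem quadForm_pos {T : H →L[ℂ] H} (hT : IsStrictlyPositive T) {x : H} (hx : x ≠ 0) :
    0 < quadForm T x := by
  obtain ⟨b, hb, rfl⟩ := CStarAlgebra.isStrictlyPositive_iff_eq_star_mul_self.1 hT
  have h := quadForm_star_conj b 1 x
  rw [mul_one, quadForm_one] at h
  rw [h]
  have hbx : b x ≠ 0 := by
    obtain ⟨u, rfl⟩ := hb
    intro h0
    apply hx
    have : ((↑u⁻¹ : H →L[ℂ] H) * (u : H →L[ℂ] H)) x = 0 := by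
      rw [mul_apply_eq_comp, h0, map_zero]
    simpa using this
  have := norm_pos_iff.2 hbx
  positivity

theorem cfc_affine {T : H →L[ℂ] H} (hT : IsSelfAdjoint T) (a b : ℝ) :
    cfc (fun x : ℝ => a * x + b) T = a • T + b • 1 := by
  rw [cfc_add_const b (fun x : ℝ => a * x) T, cfc_const_mul_id a T, Algebra.algebraMap_eq_smul_one]

theorem quadForm_cfc_le {T : H →L[ℂ] H} (hT : IsSelfAdjoint T) {g : ℝ → ℝ}
    (hg : ContinuousOn g (spectrum ℝ T)) {a b : ℝ} (h : ∀ x ∈ spectrum ℝ T, g x ≤ a * x + b)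
    (x : H) : quadForm (cfc g T) x ≤ a * quadForm T x + b * ‖x‖ ^ 2 := by
  have := quadForm_mono (cfc_mono h hg (by fun_prop)) x
  rwa [cfc_affine hT, quadForm_add, quadForm_smul, quadForm_smul, quadForm_one] at this

theorem le_quadForm_cfc {T : H →L[ℂ] H} (hT : IsSelfAdjoint T) {g : ℝ → ℝ}
    (hg : ContinuousOn g (spectrum ℝ T)) {a b : ℝ} (h : ∀ x ∈ spectrum ℝ T, a * x + b ≤ g x)
    (x : H) : a * quadForm T x + b * ‖x‖ ^ 2 ≤ quadForm (cfc g T) x := by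
  have := quadForm_mono (cfc_mono h (by fun_prop) hg) x
  rwa [cfc_affine hT, quadForm_add, quadForm_smul, quadForm_smul, quadForm_one] at this

theorem spectrum_nonneg_of_operator_nonneg {T : H →L[ℂ] H} (hT : 0 ≤ T) :
    spectrum ℝ T ⊆ Ici 0 := fun _ hx => spectrum_nonneg_of_nonneg hT hx

/-- Jensen's inequality for the quadratic form of a concave function of an operator. -/
theorem quadForm_cfc_le_map_quadForm {f : ℝ → ℝ} (hf : ConcaveOn ℝ (Ici 0) f)
    (hc : ContinuousOn f (Ici 0)) {T : H →L[ℂ] H} (hT : IsStrictlyPositive T) {x : H}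
    (hx : ‖x‖ = 1) : quadForm (cfc f T) x ≤ f (quadForm T x) := by
  have hx0 : x ≠ 0 := by rintro rfl; simp at hx
  have hsp := spectrum_nonneg_of_operator_nonneg hT.nonneg
  -- The line touches `f` at the mean value `⟨Tx, x⟩`, so its form at `x` is exactly `f ⟨Tx, x⟩`.
  obtain ⟨k, hk⟩ := hf.exists_supporting_line (quadForm_pos hT hx0)
  have := quadForm_cfc_le hT.isSelfAdjoint (hc.mono hsp) (fun y hy => hk y (hsp hy)) x
  rw [hx] at this
  linarith

/-- Hölder's inequality for the quadratic form of a power. -/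
theorem quadForm_rpow_le {T : H →L[ℂ] H} (hT : IsStrictlyPositive T) {α : ℝ} (hα0 : 0 < α)
    (hα1 : α < 1) (x : H) :
    quadForm (T ^ α) x ≤ quadForm T x ^ α * (‖x‖ ^ 2) ^ (1 - α) := by
  rcases eq_or_ne x 0 with rfl | hx
  · simp [quadForm, Real.zero_rpow hα0.ne']
  have hu := quadForm_pos hT hx
  have hv : 0 < ‖x‖ ^ 2 := by have := norm_pos_iff.2 hx; positivity
  have hsp := spectrum_nonneg_of_operator_nonneg hT.nonneg
  have hcont : ContinuousOn (fun y : ℝ => y ^ α) (spectrum ℝ T) :=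
    (Real.continuous_rpow_const hα0.le).continuousOn
  -- Tangency at `c = ⟨Tx, x⟩ / ‖x‖ ^ 2` makes the affine bound collapse to the Hölder product.
  have h := quadForm_cfc_le hT.isSelfAdjoint hcont
    (fun y hy => rpow_le_tangent hα0 hα1 (div_pos hu hv) (hsp hy)) x
  rw [← CFC.rpow_eq_cfc_real hT.nonneg] at h
  refine h.trans (le_of_eq ?_)
  set u := quadForm T x
  set v := ‖x‖ ^ 2
  rw [Real.rpow_sub_one (div_pos hu hv).ne', Real.div_rpow hu.le hv.le, Real.rpow_sub hv,
    Real.rpow_one]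
  have := Real.rpow_pos_of_pos hv α
  field_simp
  ring

/-- The reverse Hölder inequality for the quadratic form of a power. -/
theorem genKantorovich_mul_le_quadForm_rpow {T : H →L[ℂ] H} (hT : 0 ≤ T) {s t α : ℝ} (hs : 0 < s)
    (hst : s ≤ t) (hα0 : 0 < α) (hα1 : α < 1) (hsT : s • 1 ≤ T) (hTt : T ≤ t • 1) (x : H) :
    genKantorovich (t / s) α * (quadForm T x ^ α * (‖x‖ ^ 2) ^ (1 - α)) ≤ quadForm (T ^ α) x := by
  obtain ⟨a, b, ha, hb, hab, hK⟩ := exists_affine_le_rpow hs hst hα0 hα1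
  have hsa : IsSelfAdjoint T := .of_nonneg hT
  rw [← Algebra.algebraMap_eq_smul_one] at hsT hTt
  have hcont : ContinuousOn (fun y : ℝ => y ^ α) (spectrum ℝ T) :=
    (Real.continuous_rpow_const hα0.le).continuousOn
  have h := le_quadForm_cfc hsa hcont (fun y hy => hab y
    ((algebraMap_le_iff_le_spectrum hsa).1 hsT y hy)
    ((le_algebraMap_iff_spectrum_le hsa).1 hTt y hy)) x
  rw [← CFC.rpow_eq_cfc_real hT] at h
  rw [hK]
  exact (weighted_geom_le_linear hα0 hα1 ha hb (quadForm_nonneg hT x) (by positivity)).trans h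

/-! ### Weighted geometric means -/

section GeomMean

variable {A B : H →L[ℂ] H}

theorem rpow_half_mul_rpow_half (hA : IsStrictlyPositive A) :
    A ^ (1 / 2 : ℝ) * A ^ (1 / 2 : ℝ) = A := by
  rw [← CFC.rpow_add hA.isUnit]
  norm_num
  exact CFC.rpow_one A hA.nonneg

/-- With `y = A^{1/2} x` and `T = A^{-1/2} B A^{-1/2}`, the mean at `x` becomes `T ^ α` at `y`,
while `⟨Ty, y⟩ = ⟨Bx, x⟩` and `‖y‖ ^ 2 = ⟨Ax, x⟩`. Estimates for powers thus pass to means. -/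
theorem quadForm_opGeomMean (α : ℝ) (A B : H →L[ℂ] H) (x : H) :
    quadForm (opGeomMean α A B) x =
      quadForm ((A ^ (-(1 / 2) : ℝ) * B * A ^ (-(1 / 2) : ℝ)) ^ α) ((A ^ (1 / 2 : ℝ)) x) :=
  quadForm_conj (.of_nonneg CFC.rpow_nonneg) _ x

theorem quadForm_conj_rpow_neg_half (hA : IsStrictlyPositive A) (B : H →L[ℂ] H) (x : H) :
    quadForm (A ^ (-(1 / 2) : ℝ) * B * A ^ (-(1 / 2) : ℝ)) ((A ^ (1 / 2 : ℝ)) x) =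
      quadForm B x := by
  rw [quadForm_conj (.of_nonneg CFC.rpow_nonneg), ← mul_apply_eq_comp,
    CFC.rpow_neg_mul_rpow _ hA, one_apply_eq_self]

theorem norm_sq_rpow_half_apply (hA : IsStrictlyPositive A) (x : H) :
    ‖(A ^ (1 / 2 : ℝ)) x‖ ^ 2 = quadForm A x := by
  rw [← quadForm_one, ← quadForm_conj (.of_nonneg CFC.rpow_nonneg), mul_one,
    rpow_half_mul_rpow_half hA]

theorem isStrictlyPositive_conj_rpow (hA : IsStrictlyPositive A) (hB : IsStrictlyPositive B)
    (r : ℝ) : IsStrictlyPositive (A ^ r * B * A ^ r) :=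
  IsStrictlyPositive.conjugate_of_isUnit_of_isSelfAdjoint _ _ (hA.rpow A r).isUnit
    (.of_nonneg CFC.rpow_nonneg) hB

theorem opGeomMean_isStrictlyPositive (hA : IsStrictlyPositive A) (hB : IsStrictlyPositive B)
    (α : ℝ) : IsStrictlyPositive (opGeomMean α A B) :=
  isStrictlyPositive_conj_rpow hA ((isStrictlyPositive_conj_rpow hA hB _).rpow _ α) _

theorem quadForm_opGeomMean_le (hA : IsStrictlyPositive A) (hB : IsStrictlyPositive B) {α : ℝ}
    (hα0 : 0 < α) (hα1 : α < 1) (x : H) :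
    quadForm (opGeomMean α A B) x ≤ quadForm B x ^ α * quadForm A x ^ (1 - α) := by
  rw [quadForm_opGeomMean]
  refine (quadForm_rpow_le (isStrictlyPositive_conj_rpow hA hB _) hα0 hα1 _).trans_eq ?_
  rw [quadForm_conj_rpow_neg_half hA, norm_sq_rpow_half_apply hA]

theorem genKantorovich_mul_le_quadForm_opGeomMean (hA : IsStrictlyPositive A)
    (hB : IsStrictlyPositive B) {s t α : ℝ} (hs : 0 < s) (hst : s ≤ t) (hα0 : 0 < α) (hα1 : α < 1)
    (hsAB : s • A ≤ B) (htAB : B ≤ t • A) (x : H) :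
    genKantorovich (t / s) α * (quadForm B x ^ α * quadForm A x ^ (1 - α)) ≤
      quadForm (opGeomMean α A B) x := by
  have hsa : IsSelfAdjoint (A ^ (-(1 / 2) : ℝ)) := .of_nonneg CFC.rpow_nonneg
  -- Conjugation by `A^{-1/2}` turns `sA ≤ B ≤ tA` into `s ≤ T ≤ t`.
  have h1 := hsa.conjugate_le_conjugate hsAB
  have h2 := hsa.conjugate_le_conjugate htAB
  rw [mul_smul_comm, smul_mul_assoc, CFC.conjugate_rpow_neg_one_half A hA] at h1 h2
  rw [quadForm_opGeomMean]
  refine le_trans (le_of_eq ?_) (genKantorovich_mul_le_quadForm_rpow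
    (isStrictlyPositive_conj_rpow hA hB _).nonneg hs hst hα0 hα1 h1 h2 _)
  rw [quadForm_conj_rpow_neg_half hA, norm_sq_rpow_half_apply hA]

end GeomMean

end

end

noncomputable section

/-! ### Eigenvalue comparison up to unitary conjugation -/

section

variable {H : Type*} [NormedAddCommGroup H] [InnerProductSpace ℂ H]

theorem inner_apply_self_eq_sum {ι : Type*} [Fintype ι] (b : OrthonormalBasis ι ℂ H)
    {T : H →L[ℂ] H} {c : ι → ℝ} (hT : ∀ i, T (b i) = (c i : ℂ) • b i) (x : H) :
    inner ℂ (T x) x = ((∑ i, c i * ‖inner ℂ (b i) x‖ ^ 2 : ℝ) : ℂ) := by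
  have h1 : T x = ∑ i, inner ℂ (b i) x • ((c i : ℂ) • b i) := by
    conv_lhs => rw [← b.sum_repr' x]
    simp [hT]
  rw [h1, sum_inner]
  push_cast
  refine Finset.sum_congr rfl fun i _ => ?_
  rw [inner_smul_left, inner_smul_left, Complex.conj_ofReal, mul_left_comm]
  congr 1
  exact RCLike.conj_mul _

theorem quadForm_eq_sum {ι : Type*} [Fintype ι] (b : OrthonormalBasis ι ℂ H)
    {T : H →L[ℂ] H} {c : ι → ℝ} (hT : ∀ i, T (b i) = (c i : ℂ) • b i) (x : H) :
    quadForm T x = ∑ i, c i * ‖inner ℂ (b i) x‖ ^ 2 := by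
  rw [quadForm, inner_apply_self_eq_sum b hT, Complex.ofReal_re]

theorem nonneg_of_eigenbasis {ι : Type*} [Fintype ι] (b : OrthonormalBasis ι ℂ H)
    {T : H →L[ℂ] H} {c : ι → ℝ} (hT : ∀ i, T (b i) = (c i : ℂ) • b i) (hc : ∀ i, 0 ≤ c i) :
    T.IsPositive := by
  rw [ContinuousLinearMap.isPositive_iff_complex]
  intro x
  rw [inner_apply_self_eq_sum b hT]
  refine ⟨rfl, ?_⟩
  exact Finset.sum_nonneg fun i _ => mul_nonneg (hc i) (by positivity)

theorem aeval_apply_of_apply_eq_smul {T : H →L[ℂ] H} {c : ℝ} {v : H} (hv : T v = (c : ℂ) • v)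
    (P : Polynomial ℝ) : (Polynomial.aeval T P) v = ((P.eval c : ℝ) : ℂ) • v := by
  induction P using Polynomial.induction_on' with
  | add P Q hP hQ => simp [hP, hQ, add_smul]
  | monomial n a =>
    have hpow : ∀ m : ℕ, (T ^ m) v = ((c : ℂ) ^ m) • v := by
      intro m
      induction m with
      | zero => simp
      | succ m ih => rw [pow_succ, mul_apply_eq_comp, hv, map_smul, ih, smul_smul, pow_succ']
    rw [Polynomial.aeval_monomial, Algebra.algebraMap_eq_smul_one, smul_mul_assoc, one_mul,
      smul_apply, hpow, Polynomial.eval_monomial, ← Complex.coe_smul, smul_smul]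
    push_cast
    rfl

variable [FiniteDimensional ℂ H]

theorem finite_real_spectrum (T : H →L[ℂ] H) : (spectrum ℝ T).Finite := by
  rw [← spectrum.preimage_algebraMap ℂ, ContinuousLinearMap.spectrum_eq]
  exact (Module.End.finite_spectrum _).preimage (FaithfulSMul.algebraMap_injective ℝ ℂ).injOn

/-- Two orthonormal bases admit, for each index `j`, a unit vector orthogonal to the initial part
of the first and to the final part of the second. -/
theorem exists_norm_eq_one_orthogonal {n : ℕ} (b c : OrthonormalBasis (Fin n) ℂ H) (j : Fin n) :
    ∃ x : H, ‖x‖ = 1 ∧ (∀ i < j, inner ℂ (b i) x = 0) ∧ ∀ i, j < i → inner ℂ (c i) x = 0 := by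
  -- One linear condition for each index other than `j`: fewer than the dimension, so the kernel is
  -- nonzero.
  let F : H →ₗ[ℂ] ({i : Fin n // i ≠ j} → ℂ) := LinearMap.pi fun i =>
    if (i : Fin n) < j then (innerSL ℂ (b i)).toLinearMap else (innerSL ℂ (c i)).toLinearMap
  have hdim : Module.finrank ℂ ({i : Fin n // i ≠ j} → ℂ) < Module.finrank ℂ H := by
    rw [Module.finrank_fintype_fun_eq_card, Module.finrank_eq_card_basis b.toBasis]
    exact Fintype.card_subtype_lt (x := j) (by simp)
  obtain ⟨y, hy, hy0⟩ := Submodule.exists_mem_ne_zero_of_ne_bot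
    (LinearMap.ker_ne_bot_of_finrank_lt (f := F) hdim)
  have hF : ∀ i, ∀ hi : i ≠ j, F y ⟨i, hi⟩ = 0 := fun i hi => by
    rw [LinearMap.mem_ker.1 hy]; rfl
  refine ⟨((‖y‖⁻¹ : ℝ) : ℂ) • y, ?_, fun i hi => ?_, fun i hi => ?_⟩
  · rw [norm_smul, Complex.norm_real, norm_inv, norm_norm, inv_mul_cancel₀ (norm_ne_zero_iff.2 hy0)]
  · have := hF i hi.ne
    simp only [F, LinearMap.pi_apply, if_pos hi] at this
    rw [inner_smul_right, show inner ℂ (b i) y = 0 from this, mul_zero]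
  · have := hF i hi.ne'
    simp only [F, LinearMap.pi_apply, if_neg hi.not_gt] at this
    rw [inner_smul_right, show inner ℂ (c i) y = 0 from this, mul_zero]

variable [CompleteSpace H]

/-- The spectrum is finite, so `f` may be replaced by an interpolating polynomial, which acts on `v`
by its value at `c`. -/
theorem cfc_apply_of_apply_eq_smul {T : H →L[ℂ] H} (hT : IsSelfAdjoint T) (f : ℝ → ℝ) {c : ℝ}
    {v : H} (hv : T v = (c : ℂ) • v) : cfc f T v = (f c : ℂ) • v := by
  classical
  set S : Finset ℝ := insert c (finite_real_spectrum T).toFinset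
  set P : Polynomial ℝ := Lagrange.interpolate S id f
  have hP : ∀ x ∈ S, P.eval x = f x := fun x hx =>
    Lagrange.eval_interpolate_at_node (v := id) f (injOn_id _) hx
  have h1 : cfc f T = cfc (fun x => P.eval x) T :=
    cfc_congr fun x hx => (hP x (by simp [S, hx])).symm
  rw [h1, cfc_polynomial P T, aeval_apply_of_apply_eq_smul hv, hP c (by simp [S])]

/-- If `⟪Z x, x⟫ ≤ f ⟪X x, x⟫` for all unit vectors `x`, then the ordered eigenvalues of `Z` are
dominated by those of `f(X)`, that is, a unitary conjugate of `Z` is at most `f(X)`. -/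
theorem exists_unitary_conj_le_cfc {f : ℝ → ℝ} (hf : MonotoneOn f (Ici 0)) {X Z : H →L[ℂ] H}
    (hX : 0 ≤ X) (hZ : IsSelfAdjoint Z)
    (h : ∀ x : H, ‖x‖ = 1 → quadForm Z x ≤ f (quadForm X x)) :
    ∃ U ∈ unitary (H →L[ℂ] H), U * Z * star U ≤ cfc f X := by
  have hXsa : IsSelfAdjoint X := .of_nonneg hX
  have hXs := hXsa.isSymmetric
  have hZs := hZ.isSymmetric
  let b := hXs.eigenvectorBasis rfl
  let c := hZs.eigenvectorBasis rfl
  let l := hXs.eigenvalues rfl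
  let m := hZs.eigenvalues rfl
  have hb : ∀ i, X (b i) = (l i : ℂ) • b i := hXs.apply_eigenvectorBasis rfl
  have hc : ∀ i, Z (c i) = (m i : ℂ) • c i := hZs.apply_eigenvectorBasis rfl
  have hl : Antitone l := hXs.eigenvalues_antitone rfl
  have hm : Antitone m := hZs.eigenvalues_antitone rfl
  -- Courant-Fischer: some unit `x` lies in the span of the `b i` with `i ≥ j` and of the `c i` with
  -- `i ≤ j`, hence `m j ≤ ⟨Zx, x⟩ ≤ f ⟨Xx, x⟩ ≤ f (l j)`.
  have hml : ∀ j, m j ≤ f (l j) := by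
    intro j
    obtain ⟨x, hx, hxb, hxc⟩ := exists_norm_eq_one_orthogonal b c j
    have hsum : ∀ d : OrthonormalBasis (Fin (Module.finrank ℂ H)) ℂ H,
        ∑ i, ‖inner ℂ (d i) x‖ ^ 2 = 1 := fun d => by
      rw [d.sum_sq_norm_inner_right, hx, one_pow]
    have h1 : quadForm X x ≤ l j := by
      rw [quadForm_eq_sum b hb, ← mul_one (l j), ← hsum b, Finset.mul_sum]
      refine Finset.sum_le_sum fun i _ => ?_
      rcases lt_or_ge i j with hij | hij
      · simp [hxb i hij]
      · exact mul_le_mul_of_nonneg_right (hl hij) (by positivity)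
    have h2 : m j ≤ quadForm Z x := by
      rw [quadForm_eq_sum c hc, ← mul_one (m j), ← hsum c, Finset.mul_sum]
      refine Finset.sum_le_sum fun i _ => ?_
      rcases lt_or_ge j i with hij | hij
      · simp [hxc i hij]
      · exact mul_le_mul_of_nonneg_right (hm hij) (by positivity)
    have h0 := quadForm_nonneg hX x
    exact h2.trans ((h x hx).trans (hf (mem_Ici.2 h0) (mem_Ici.2 (h0.trans h1)) h1))
  -- `U` matches eigenvectors of equal rank, so `f(X) - U Z U*` is diagonal in `b` with entries `f
  -- (l i) - m i`.
  let e : H ≃ₗᵢ[ℂ] H := c.equiv b (Equiv.refl _)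
  let U := Unitary.linearIsometryEquiv.symm e
  have hU : ∀ i, (U : H →L[ℂ] H) (c i) = b i := fun i => by
    change e (c i) = b i
    simp [e]
  have hU' : ∀ i, (star (U : H →L[ℂ] H)) (b i) = c i := fun i => by
    rw [← hU i, ← mul_apply_eq_comp, Unitary.coe_star_mul_self, one_apply_eq_self]
  refine ⟨U, U.2, ?_⟩
  rw [ContinuousLinearMap.le_def]
  refine nonneg_of_eigenbasis b (c := fun i => f (l i) - m i) (fun i => ?_)
    fun i => sub_nonneg.2 (hml i)
  rw [sub_apply, mul_apply_eq_comp, mul_apply_eq_comp, hU', hc, map_smul, hU,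
    cfc_apply_of_apply_eq_smul hXsa f (hb i), ← sub_smul]
  push_cast
  rfl

end

end

noncomputable section

/-! ### The reverse inequalities for doubly concave functions -/

section

variable {H : Type*} [NormedAddCommGroup H] [InnerProductSpace ℂ H] [CompleteSpace H]

theorem cfc_isStrictlyPositive {f : ℝ → ℝ} (hf : ContinuousOn f (Ici 0))
    (hpos : ∀ x, 0 < x → 0 < f x) {T : H →L[ℂ] H} (hT : IsStrictlyPositive T) :
    IsStrictlyPositive (cfc f T) := by
  have hsp := spectrum_nonneg_of_operator_nonneg hT.nonneg
  refine CStarAlgebra.isStrictlyPositive_iff_isSelfAdjoint_and_spectrum_pos.2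
    ⟨cfc_predicate f T, fun x hx => ?_⟩
  rw [cfc_map_spectrum f T hT.isSelfAdjoint (hf.mono hsp)] at hx
  obtain ⟨y, hy, rfl⟩ := hx
  exact hpos y ((StarOrderedRing.isStrictlyPositive_iff_spectrum_pos T).1 hT y hy)

theorem cfc_smul_le_smul_cfc {f : ℝ → ℝ} (hf : DoublyConcaveOn (Ici 0) f) {T : H →L[ℂ] H}
    (hT : 0 ≤ T) {k : ℝ} (hk : 1 ≤ k) : cfc f (k • T) ≤ k • cfc f T := by
  have hsp := spectrum_nonneg_of_operator_nonneg hT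
  have hmaps : MapsTo (fun x : ℝ => k * x) (Ici 0) (Ici 0) := fun x hx =>
    mem_Ici.2 (mul_nonneg (by linarith) hx)
  have himg : ContinuousOn f ((fun x : ℝ => k • x) '' spectrum ℝ T) :=
    hf.continuousOn.mono (hmaps.mono_left hsp).image_subset
  rw [← cfc_comp_smul k f T himg (.of_nonneg hT), ← cfc_smul k f T (hf.continuousOn.mono hsp)]
  refine cfc_mono (fun x hx => ?_) (himg.comp (by fun_prop) (mapsTo_image _ _))
    ((hf.continuousOn.mono hsp).const_smul k)
  exact hf.concave.map_mul_le_mul (hf.nonneg 0 (mem_Ici.2 le_rfl)) hk (hsp hx)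

theorem smul_cfc_le_cfc_smul {f : ℝ → ℝ} (hf : DoublyConcaveOn (Ici 0) f) {T : H →L[ℂ] H}
    (hT : 0 ≤ T) {k : ℝ} (hk0 : 0 ≤ k) (hk1 : k ≤ 1) : k • cfc f T ≤ cfc f (k • T) := by
  have hsp := spectrum_nonneg_of_operator_nonneg hT
  have hmaps : MapsTo (fun x : ℝ => k * x) (Ici 0) (Ici 0) := fun x hx =>
    mem_Ici.2 (mul_nonneg hk0 hx)
  have himg : ContinuousOn f ((fun x : ℝ => k • x) '' spectrum ℝ T) :=
    hf.continuousOn.mono (hmaps.mono_left hsp).image_subset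
  rw [← cfc_comp_smul k f T himg (.of_nonneg hT), ← cfc_smul k f T (hf.continuousOn.mono hsp)]
  refine cfc_mono (fun x hx => ?_) ((hf.continuousOn.mono hsp).const_smul k)
    (himg.comp (by fun_prop) (mapsTo_image _ _))
  exact hf.concave.mul_le_map_mul (hf.nonneg 0 (mem_Ici.2 le_rfl)) hk0 hk1 (hsp hx)

/-- The outer factors `0 ^ (1/2)` vanish whatever the negative powers of `0` are, so the convention
`0 ♯ 0 = 0` holds automatically when `f` is zero. -/
theorem opGeomMean_zero (α : ℝ) (B : H →L[ℂ] H) : opGeomMean α 0 B = 0 := by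
  have h : (0 : H →L[ℂ] H) ^ (1 / 2 : ℝ) = 0 := CFC.zero_rpow (by norm_num)
  rw [opGeomMean, h, zero_mul, zero_mul]

theorem genKantorovich_mul_quadForm_opGeomMean_cfc_le {f : ℝ → ℝ}
    (hf : DoublyConcaveOn (Ici 0) f) (hmono : MonotoneOn f (Ici 0))
    (hpos : ∀ x, 0 < x → 0 < f x) {C D : H →L[ℂ] H} (hC : IsStrictlyPositive C)
    (hD : IsStrictlyPositive D) {s t α : ℝ} (hs : 0 < s) (hst : s ≤ t) (hα0 : 0 < α) (hα1 : α < 1)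
    (hsCD : s • C ≤ D) (htCD : D ≤ t • C) {x : H} (hx : ‖x‖ = 1) :
    genKantorovich (t / s) α * quadForm (opGeomMean α (cfc f C) (cfc f D)) x ≤
      f (quadForm (opGeomMean α C D) x) := by
  have hfC := cfc_isStrictlyPositive hf.continuousOn hpos hC
  have hfD := cfc_isStrictlyPositive hf.continuousOn hpos hD
  have hK0 := genKantorovich_nonneg hs hst hα0 hα1
  have hK1 := genKantorovich_le_one hs hst hα0 hα1
  have hα : 0 ≤ 1 - α := (sub_pos.2 hα1).le
  have hc0 := quadForm_nonneg hC.nonneg x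
  have hd0 := quadForm_nonneg hD.nonneg x
  have hG : 0 ≤ quadForm D x ^ α * quadForm C x ^ (1 - α) := by positivity
  have hfd := hf.nonneg _ (mem_Ici.2 hd0)
  calc genKantorovich (t / s) α * quadForm (opGeomMean α (cfc f C) (cfc f D)) x
      ≤ genKantorovich (t / s) α *
          (quadForm (cfc f D) x ^ α * quadForm (cfc f C) x ^ (1 - α)) :=
        mul_le_mul_of_nonneg_left (quadForm_opGeomMean_le hfC hfD hα0 hα1 x) hK0
    _ ≤ genKantorovich (t / s) α * (f (quadForm D x) ^ α * f (quadForm C x) ^ (1 - α)) := by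
        refine mul_le_mul_of_nonneg_left (mul_le_mul ?_ ?_ ?_ ?_) hK0
        · exact Real.rpow_le_rpow (quadForm_nonneg hfD.nonneg x)
            (quadForm_cfc_le_map_quadForm hf.concave hf.continuousOn hD hx) hα0.le
        · exact Real.rpow_le_rpow (quadForm_nonneg hfC.nonneg x)
            (quadForm_cfc_le_map_quadForm hf.concave hf.continuousOn hC hx) hα
        · exact Real.rpow_nonneg (quadForm_nonneg hfC.nonneg x) _
        · exact Real.rpow_nonneg hfd _
    _ ≤ genKantorovich (t / s) α * f (quadForm D x ^ α * quadForm C x ^ (1 - α)) :=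
        mul_le_mul_of_nonneg_left (hf.geomConcave _ (mem_Ici.2 hd0) _ (mem_Ici.2 hc0) α
          ⟨hα0.le, hα1.le⟩) hK0
    _ ≤ f (genKantorovich (t / s) α * (quadForm D x ^ α * quadForm C x ^ (1 - α))) :=
        hf.concave.mul_le_map_mul (hf.nonneg 0 (mem_Ici.2 le_rfl)) hK0 hK1 hG
    _ ≤ f (quadForm (opGeomMean α C D) x) :=
        hmono (mem_Ici.2 (mul_nonneg hK0 hG))
          (mem_Ici.2 (quadForm_nonneg (opGeomMean_isStrictlyPositive hC hD α).nonneg x))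
          (genKantorovich_mul_le_quadForm_opGeomMean hC hD hs hst hα0 hα1 hsCD htCD x)

end

end

theorem mainTheorem5 {H : Type*} [NormedAddCommGroup H] [InnerProductSpace ℂ H] [CompleteSpace H]
    [FiniteDimensional ℂ H] (f : ℝ → ℝ) (hf : DoublyConcaveOn (Set.Ici 0) f)
    (hmono : MonotoneOn f (Set.Ici 0)) (p q : ℝ) (hp : 1 < p) (hq : 1 < q)
    (hpq : 1 / p + 1 / q = 1) (s t : ℝ) (hs : 0 < s) (hst : s ≤ t)
    (A B : H →L[ℂ] H) (hA : 0 ≤ A) (hB : 0 ≤ B) (hpos : IsStrictlyPositive (s • A ^ p))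
    (hsAB : s • A ^ p ≤ B ^ q) (htAB : B ^ q ≤ t • A ^ p) :
    ∃ U ∈ unitary (H →L[ℂ] H),
      genKantorovich (t / s) (1 / q) •
          (U * opGeomMean (1 / q) (cfc f (A ^ p)) (cfc f (B ^ q)) * star U) ≤
        cfc f (opGeomMean (1 / q) (A ^ p) (B ^ q)) ∧
      (OperatorMonotone H f → s ≤ 1 → 1 ≤ t → ∀ x : H,
        genKantorovich (t / s) (1 / q) ^ 2 *
            ((inner ℂ (cfc f (A ^ p) x) x).re ^ (1 / p) *
              (inner ℂ (cfc f (B ^ q) x) x).re ^ (1 / q)) ≤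
          (inner ℂ (cfc f (opGeomMean (1 / q) (A ^ p) (B ^ q)) (U x)) (U x)).re) := by
  have hα0 : 0 < 1 / q := by positivity
  have hα1 : 1 / q < 1 := (div_lt_one (by linarith)).2 hq
  have hp' : 1 / p = 1 - 1 / q := by linarith
  have hC : IsStrictlyPositive (A ^ p) := by
    simpa [smul_smul, hs.ne'] using IsStrictlyPositive.smul (inv_pos.2 hs) hpos
  have hD : IsStrictlyPositive (B ^ q) := hpos.of_le hsAB
  rw [hp']
  clear hp hpq hA hB hp'
  generalize A ^ p = C at *
  generalize B ^ q = D at *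
  generalize 1 / q = α at *
  have hX := opGeomMean_isStrictlyPositive hC hD α
  rcases hf.concave.eq_zero_or_pos hmono hf.nonneg with h0 | hfpos
  · have hz : ∀ T : H →L[ℂ] H, 0 ≤ T → cfc f T = 0 := fun T hT => by
      rw [cfc_congr (g := fun _ => 0) fun x hx => h0 x (spectrum_nonneg_of_operator_nonneg hT hx),
        cfc_const_zero]
    refine ⟨1, one_mem _, ?_, fun _ _ _ x => ?_⟩
    · rw [hz C hC.nonneg, hz _ hX.nonneg, opGeomMean_zero]
      simp
    · rw [hz C hC.nonneg, hz D hD.nonneg, hz _ hX.nonneg]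
      simp [Real.zero_rpow hα0.ne']
  have hK0 := genKantorovich_nonneg hs hst hα0 hα1
  have hfC := cfc_isStrictlyPositive hf.continuousOn hfpos hC
  have hfD := cfc_isStrictlyPositive hf.continuousOn hfpos hD
  obtain ⟨U, hU, hle⟩ := exists_unitary_conj_le_cfc hmono hX.nonneg
    (Z := genKantorovich (t / s) α • opGeomMean α (cfc f C) (cfc f D))
    ((IsSelfAdjoint.all _).smul (opGeomMean_isStrictlyPositive hfC hfD α).isSelfAdjoint)
    fun x hx => by
      rw [quadForm_smul]
      exact genKantorovich_mul_quadForm_opGeomMean_cfc_le hf hmono hfpos hC hD hs hst hα0 hα1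
        hsAB htAB hx
  rw [mul_smul_comm, smul_mul_assoc] at hle
  refine ⟨U, hU, hle, fun hop hs1 ht1 x => ?_⟩
  have hsf : s • cfc f C ≤ cfc f D :=
    (smul_cfc_le_cfc_smul hf hC.nonneg hs.le hs1).trans (hop _ _ hD hpos hsAB)
  have htf : cfc f D ≤ t • cfc f C :=
    (hop _ _ (IsStrictlyPositive.smul (by linarith) hC) hD htAB).trans
      (cfc_smul_le_smul_cfc hf hC.nonneg ht1)
  have h1 := genKantorovich_mul_le_quadForm_opGeomMean hfC hfD hs hst hα0 hα1 hsf htf x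
  have h2 := quadForm_mono hle (U x)
  rw [quadForm_smul] at h2
  -- At the vector `U x` the conjugation by `U` cancels, leaving the form of the mean at `x`.
  have h3 := quadForm_star_conj (star U) (opGeomMean α (cfc f C) (cfc f D)) (U x)
  rw [star_star, ← mul_apply_eq_comp, Unitary.star_mul_self_of_mem hU, one_apply_eq_self] at h3
  rw [h3] at h2
  refine le_trans ?_ h2
  rw [sq, mul_assoc]
  refine mul_le_mul_of_nonneg_left (le_trans (le_of_eq ?_) h1) hK0
  rw [mul_comm (quadForm _ _ ^ _)]
  rfl
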